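/- For $d>0$ let $\mathscr{D}_d=\{\zeta\in\mathbb{C}:|\operatorname{Im}\zeta|<d\}$, $\mathscr{D}_d^{+}=\{\zeta\in\mathscr{D}_d:\operatorname{Re}\zeta\ge 0\}$, $\mathscr{D}_d^{-}=\{\zeta\in\mathscr{D}_d:\operatorname{Re}\zeta<0\}$, and let $\phi(\zeta)=2\sinh(\log(\log(1+e^{\zeta})))$ (principal logarithms). Assume that $f$ is analytic in $\phi(\mathscr{D}_d)$ with $0<d<(1+\pi)/2$, and that there are positive constants $K,\alpha,\beta$ such that $$|f(z)|\le K|e^{-z}|^{\beta}\quad(z\in\phi(\mathscr{D}_d^{+})),\qquad |f(z)|\le \frac{K}{|4+z^2|^{1/2}|z|^{\alpha}}\quad(z\in\phi(\mathscr{D}_d^{-})).$$ Let $\mu=\min\{\alpha,\beta\}$. For a positive integer $n$ let $M=n$, $N=\lceil\alpha n/\beta\rceil$ if $\mu=\alpha$, let $N=n$, $M=\lceil\beta n/\alpha\rceil$ if $\mu=\beta$, and let $h=\sqrt{2\pi d/(\mu n)}$. Then $f$ is integrable over $\mathbb{R}$, and for every positive integer $n$ $$\left|\int_{-\infty}^{\infty}f(x)\,dx-h\sum_{k=-M}^{N}f(\phi(kh))\phi'(kh)\right|\le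 K\left(\frac{2C_5}{1-e^{-\sqrt{2\pi d\mu}}}+C_6\right)e^{-\sqrt{2\pi d\mu n}},$$ where, with $c_d=1/\cos(d/2)$ and $\lambda=1/\log 2$, $$C_5=\frac1\alpha\left\{\frac{e\,c_d}{(1-\log 2)(e-1)}\right\}^{\alpha}\frac{1+c_d}{\log(2+c_d)}+\frac{(1+\lambda^2)c_d}{\beta}\left(e^{\lambda}c_d\right)^{\beta},\qquad C_6=\frac{1}{\alpha(1-\log 2)^{\alpha}}+\frac{1+\lambda^2}{\beta}\left(e^{\lambda}\right)^{\beta}.$$ Moreover $C_5<C_3$ and $C_6<C_4$, where $$C_3=\left(\frac{1}{\alpha+1}+\frac1\alpha\right)\left\{\frac{e\,c_d}{(1-\log 2)(e-1)}\right\}^{\alpha+1}\frac{1+\{\log(2+c_d)\}^2}{\{\log(2+c_d)\}^2}(1+c_d)^2+\frac{(1+\lambda^2)c_d}{\beta}\left(e^{\lambda}c_d\right)^{\beta},$$ $$C_4=\frac{e^{1/\pi^3}}{\alpha(1-\log 2)^{\alpha+1}}+\frac{1+\lambda^2}{\beta}\left(e^{\lambda}\right)^{\beta}.$$ -/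

import Mathlib

open Set MeasureTheory

noncomputable section

namespace UnilateralTrapezoid

/-- The open strip `{ζ : |Im ζ| < d}`. -/
def strip (d : ℝ) : Set ℂ := {ζ | |ζ.im| < d}

/-- The part of the strip with `Re ζ < 0`. -/
def stripNeg (d : ℝ) : Set ℂ := {ζ | ζ ∈ strip d ∧ ζ.re < 0}

/-- The part of the strip with `Re ζ ≥ 0`. -/
def stripPos (d : ℝ) : Set ℂ := {ζ | ζ ∈ strip d ∧ 0 ≤ ζ.re}

/-- The conformal map `φ(ζ) = 2 sinh (log (log (1 + e^ζ)))` (principal logarithms). -/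
def phi (ζ : ℂ) : ℂ := 2 * Complex.sinh (Complex.log (Complex.log (1 + Complex.exp ζ)))

/-- The lower truncation index `M`. -/
def truncM (α β : ℝ) (n : ℕ) : ℕ := if min α β = α then n else ⌈β * n / α⌉₊

/-- The upper truncation index `N`. -/
def truncN (α β : ℝ) (n : ℕ) : ℕ := if min α β = α then ⌈α * n / β⌉₊ else n

/-- The mesh size `h = √(2πd / (μ n))` with `μ = min α β`. -/
def mesh (d α β : ℝ) (n : ℕ) : ℝ := Real.sqrt (2 * Real.pi * d / (min α β * n))

/-- The truncated trapezoidal sum `h ∑_{k=-M}^{N} f(φ(kh)) φ'(kh)`. -/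
def trapezoid (f : ℂ → ℂ) (h : ℝ) (M N : ℕ) : ℂ :=
  (h : ℂ) * ∑ k ∈ Finset.Icc (-(M : ℤ)) (N : ℤ),
    f (phi ((k : ℂ) * (h : ℂ))) * deriv phi ((k : ℂ) * (h : ℂ))

/-- `c_d = 1 / cos (d/2)`. -/
def cConst (d : ℝ) : ℝ := 1 / Real.cos (d / 2)

/-- `λ = 1 / log 2`. -/
def lamConst : ℝ := 1 / Real.log 2

/-- The first constant of the error bound under the general decay condition. -/
def C3 (d α β : ℝ) : ℝ :=
  (1 / (α + 1) + 1 / α)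
      * (Real.exp 1 * cConst d / ((1 - Real.log 2) * (Real.exp 1 - 1))) ^ (α + 1)
      * ((1 + Real.log (2 + cConst d) ^ 2) / Real.log (2 + cConst d) ^ 2)
      * (1 + cConst d) ^ 2
    + (1 + lamConst ^ 2) * cConst d / β * (Real.exp lamConst * cConst d) ^ β

/-- The second constant of the error bound under the general decay condition. -/
def C4 (α β : ℝ) : ℝ :=
  Real.exp (1 / Real.pi ^ 3) / (α * (1 - Real.log 2) ^ (α + 1))
    + (1 + lamConst ^ 2) / β * Real.exp lamConst ^ β

/-- The first constant of the error bound under the special decay condition. -/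
def C5 (d α β : ℝ) : ℝ :=
  1 / α * (Real.exp 1 * cConst d / ((1 - Real.log 2) * (Real.exp 1 - 1))) ^ α
      * ((1 + cConst d) / Real.log (2 + cConst d))
    + (1 + lamConst ^ 2) * cConst d / β * (Real.exp lamConst * cConst d) ^ β

/-- The second constant of the error bound under the special decay condition. -/
def C6 (α β : ℝ) : ℝ :=
  1 / (α * (1 - Real.log 2) ^ α)
    + (1 + lamConst ^ 2) / β * Real.exp lamConst ^ β

end UnilateralTrapezoid

end

/-! The substitution `x = φ(t)` turns the integral of `f` into that of `F = (f ∘ φ) φ'`, which is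
analytic in the strip `|Im ζ| < d`. The proof has three ingredients.

*Pointwise bounds.* With `L(ζ) = log (1 + e^ζ)` one has `φ = L - 1/L`, `4 + φ² = (L + 1/L)²` and
`φ' = (L'/L) (L + 1/L)`. Hence on `Re ζ < 0` the square root in the hypothesis on `f` cancels, and
`|F| ≤ K |L'/L| |φ|^{-α}`. The factor `|L'/L|` is bounded through `|L| ≥ log (1 + |1 - e^{-L}|)` and
Bernoulli's inequality (`norm_logDeriv_softplus_le`). Since `φ = (L - 1)(L + 1)/L`, bounding `1/|φ|`
by a multiple of `e^{Re ζ}` requires keeping `L` away from `±1`: `Re L ≤ log 2` takes care of `1`,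
and `d < (1 + π)/2 < 2π/3` keeps `1 + e^ζ` away from `0`, so that `Re L ≥ -1/6`
(`norm_phi_inv_le`). On `Re ζ ≥ 0` one uses `|e^{-φ}| ≤ e^{1/|L|} / |1 + e^ζ|`, `|L| ≥ log 2` and
`|1 + e^ζ| ≥ cos (Im ζ / 2) (1 + e^{Re ζ})`. In total, `F` has a two-sided exponential majorant
whose integral is `K C₅`; on the real axis the same estimates give one with integral `K C₆`.

*Discretization error.* Shifting the line of integration gives `|𝓕 F (ξ)| ≤ K C₅ e^{-2πd|ξ|}`
(`norm_fourier_le`). By Poisson summation the error of the full trapezoidal sum is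
`∑_{k ≠ 0} (𝓕 F)(k/h)`, a geometric series (`norm_integral_sub_mesh_mul_tsum_le`).

*Truncation error.* The discarded terms are bounded by geometric series as well
(`mesh_mul_norm_tsum_sub_sum_le`). The choice of `M`, `N` and `h` makes `e^{-2πd/h}` equal to
`e^{-√(2πdμn)}`, and `e^{-αMh}` and `e^{-βNh}` at most that. -/

namespace UnilateralTrapezoid

open Filter Topology FourierTransform


/-! ### Two-sided exponential majorants -/

/-- The majorant equal to `Q e^{αx}` on `x < 0` and to `P e^{-βx}` on `x ≥ 0`. -/
noncomputable def envelope (Q P α β x : ℝ) : ℝ :=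
  if x < 0 then Q * Real.exp (α * x) else P * Real.exp (-β * x)

theorem envelope_mul_left (Q P α β x : ℝ) {h : ℝ} (hh : 0 < h) :
    envelope Q P α β (h * x) = envelope Q P (α * h) (β * h) x := by
  unfold envelope
  have : h * x < 0 ↔ x < 0 := by
    constructor
    · intro H; by_contra! H'; nlinarith
    · intro H; nlinarith
  simp only [this]
  congr 3 <;> ring

theorem envelope_eqOn_Iio (Q P α β : ℝ) :
    EqOn (envelope Q P α β) (fun x => Q * Real.exp (α * x)) (Iio 0) := fun x hx => by
  rw [envelope, if_pos (mem_Iio.mp hx)]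

theorem envelope_eqOn_Ici (Q P α β : ℝ) :
    EqOn (envelope Q P α β) (fun x => P * Real.exp (-β * x)) (Ici 0) := fun x hx => by
  rw [envelope, if_neg (not_lt.mpr (mem_Ici.mp hx))]

theorem integrable_envelope (Q P : ℝ) {α β : ℝ} (hα : 0 < α) (hβ : 0 < β) :
    Integrable (envelope Q P α β) := by
  rw [← integrableOn_univ, ← Iio_union_Ici (a := (0 : ℝ)), integrableOn_union]
  constructor
  · rw [integrableOn_congr_fun (envelope_eqOn_Iio Q P α β) measurableSet_Iio]
    exact ((integrableOn_exp_mul_Iic hα 0).mono_set Iio_subset_Iic_self).const_mul Q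
  · rw [integrableOn_congr_fun (envelope_eqOn_Ici Q P α β) measurableSet_Ici,
      integrableOn_Ici_iff_integrableOn_Ioi]
    exact (integrableOn_exp_mul_Ioi (neg_lt_zero.mpr hβ) 0).const_mul P

theorem integral_envelope (Q P : ℝ) {α β : ℝ} (hα : 0 < α) (hβ : 0 < β) :
    ∫ x, envelope Q P α β x = Q / α + P / β := by
  have hi := integrable_envelope Q P hα hβ
  rw [← integral_add_compl measurableSet_Iio hi (s := Iio 0), compl_Iio,
    setIntegral_congr_fun measurableSet_Iio (envelope_eqOn_Iio Q P α β),
    setIntegral_congr_fun measurableSet_Ici (envelope_eqOn_Ici Q P α β),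
    integral_Ici_eq_integral_Ioi, ← integral_Iic_eq_integral_Iio, integral_const_mul,
    integral_const_mul, integral_exp_mul_Iic hα, integral_exp_mul_Ioi (neg_lt_zero.mpr hβ)]
  simp [div_eq_mul_inv]

theorem tendsto_envelope_atTop (Q P α : ℝ) {β : ℝ} (hβ : 0 < β) :
    Tendsto (envelope Q P α β) atTop (𝓝 0) := by
  have h : Tendsto (fun x : ℝ => P * Real.exp (-β * x)) atTop (𝓝 (P * 0)) :=
    (Real.tendsto_exp_atBot.comp
      (tendsto_id.const_mul_atTop_of_neg (neg_lt_zero.mpr hβ))).const_mul P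
  rw [mul_zero] at h
  refine h.congr' ?_
  filter_upwards [eventually_ge_atTop 0] with x hx
  exact (envelope_eqOn_Ici Q P α β hx).symm

theorem tendsto_envelope_atBot (Q P β : ℝ) {α : ℝ} (hα : 0 < α) :
    Tendsto (envelope Q P α β) atBot (𝓝 0) := by
  have h : Tendsto (fun x : ℝ => Q * Real.exp (α * x)) atBot (𝓝 (Q * 0)) :=
    (Real.tendsto_exp_atBot.comp (tendsto_id.const_mul_atBot hα)).const_mul Q
  rw [mul_zero] at h
  refine h.congr' ?_
  filter_upwards [eventually_lt_atBot 0] with x hx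
  exact (envelope_eqOn_Iio Q P α β hx).symm

/-- Any exponential decay beats `|x|⁻²`. -/
theorem envelope_isBigO (Q P : ℝ) {α β : ℝ} (hα : 0 < α) (hβ : 0 < β) :
    envelope Q P α β =O[cocompact ℝ] fun x => |x| ^ (-2 : ℝ) := by
  rw [cocompact_eq_atBot_atTop, Asymptotics.isBigO_sup]
  constructor
  · have h := ((isLittleO_exp_neg_mul_rpow_atTop hα (-2)).isBigO.const_mul_left Q).comp_tendsto
      tendsto_neg_atBot_atTop
    refine h.congr' ?_ ?_
    · filter_upwards [eventually_lt_atBot 0] with x hx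
      rw [envelope_eqOn_Iio Q P α β hx]
      simp
    · filter_upwards [eventually_lt_atBot 0] with x hx
      rw [abs_of_neg hx]
      rfl
  · have h := (isLittleO_exp_neg_mul_rpow_atTop hβ (-2)).isBigO.const_mul_left P
    refine h.congr' ?_ ?_
    · filter_upwards [eventually_ge_atTop 0] with x hx
      rw [envelope_eqOn_Ici Q P α β hx]
    · filter_upwards [eventually_ge_atTop 0] with x hx
      rw [abs_of_nonneg hx]

/-! ### Shifting the line of integration in a strip -/

theorem isOpen_strip (d : ℝ) : IsOpen (strip d) :=
  isOpen_lt (by fun_prop) continuous_const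

theorem add_mul_I_mem_strip {d y : ℝ} (hy : |y| < d) (x : ℝ) :
    (x : ℂ) + y * Complex.I ∈ strip d := by
  simpa [strip] using hy

theorem ofReal_mem_strip {d : ℝ} (hd : 0 < d) (x : ℝ) : (x : ℂ) ∈ strip d := by
  simpa [strip] using hd

theorem continuous_horizontal {G : ℂ → ℂ} {d : ℝ} (hG : DifferentiableOn ℂ G (strip d)) {y : ℝ}
    (hy : |y| < d) : Continuous fun x : ℝ => G (x + y * Complex.I) :=
  hG.continuousOn.comp_continuous (by fun_prop) (add_mul_I_mem_strip hy)

theorem integrable_horizontal {G : ℂ → ℂ} {E : ℝ → ℝ} {d : ℝ}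
    (hG : DifferentiableOn ℂ G (strip d)) (hE : Integrable E)
    (hGE : ∀ ζ ∈ strip d, ‖G ζ‖ ≤ E ζ.re) {y : ℝ} (hy : |y| < d) :
    Integrable fun x : ℝ => G (x + y * Complex.I) := by
  refine hE.mono' (continuous_horizontal hG hy).aestronglyMeasurable (ae_of_all _ fun x => ?_)
  simpa using hGE _ (add_mul_I_mem_strip hy x)

/-- Cauchy's theorem on rectangles `[-R, R] × [0, y]`, `R → ∞`: the vertical sides contribute
at most `E (±R) |y|`. -/
theorem integral_horizontal_eq {G : ℂ → ℂ} {E : ℝ → ℝ} {d : ℝ}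
    (hG : DifferentiableOn ℂ G (strip d)) (hE : Integrable E)
    (hbot : Tendsto E atBot (𝓝 0)) (htop : Tendsto E atTop (𝓝 0))
    (hGE : ∀ ζ ∈ strip d, ‖G ζ‖ ≤ E ζ.re) {y : ℝ} (hy : |y| < d) :
    ∫ x : ℝ, G (x + y * Complex.I) = ∫ x : ℝ, G x := by
  have hd : 0 < d := (abs_nonneg y).trans_lt hy
  have hyd : ∀ t ∈ uIcc 0 y, |t| < d := by
    intro t ht
    have := abs_sub_left_of_mem_uIcc ht
    simp only [sub_zero] at this
    exact this.trans_lt hy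
  have hrect : ∀ R : ℝ, (∫ x in (-R)..R, G x) - (∫ x in (-R)..R, G (x + y * Complex.I)) +
      Complex.I * (∫ t in (0 : ℝ)..y, G (R + t * Complex.I)) -
      Complex.I * (∫ t in (0 : ℝ)..y, G ((-R : ℝ) + t * Complex.I)) = 0 := by
    intro R
    have := Complex.integral_boundary_rect_eq_zero_of_differentiableOn G ((-R : ℝ) : ℂ)
      ((R : ℂ) + y * Complex.I) (hG.mono fun ζ hζ => by
        rw [Complex.mem_reProdIm] at hζ
        exact hyd _ (by simpa using hζ.2))
    simpa using this
  have hside : ∀ l : Filter ℝ, ∀ s : ℝ → ℝ, Tendsto (fun R => E (s R)) l (𝓝 0) →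
      Tendsto (fun R => Complex.I * ∫ t in (0 : ℝ)..y, G (s R + t * Complex.I)) l (𝓝 0) := by
    intro l s hs
    have h0 : Tendsto (fun R => E (s R) * |y - 0|) l (𝓝 0) := by simpa using hs.mul_const |y - 0|
    refine squeeze_zero_norm (fun R => ?_) h0
    rw [norm_mul, Complex.norm_I, one_mul]
    refine intervalIntegral.norm_integral_le_of_norm_le_const fun t ht => ?_
    simpa using hGE _ (add_mul_I_mem_strip (hyd t (uIoc_subset_uIcc ht)) (s R))
  have h0 : Integrable fun x : ℝ => G x := by
    simpa using integrable_horizontal hG hE hGE (y := 0) (by simpa using hd)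
  have hlim := (((intervalIntegral_tendsto_integral h0 tendsto_neg_atTop_atBot tendsto_id).sub
    (intervalIntegral_tendsto_integral (integrable_horizontal hG hE hGE hy)
      tendsto_neg_atTop_atBot tendsto_id)).add
    (hside atTop (fun R => R) htop)).sub
    (hside atTop (fun R => -R) (hbot.comp tendsto_neg_atTop_atBot))
  have := tendsto_nhds_unique (hlim.congr hrect) tendsto_const_nhds
  simp only [add_zero, sub_zero] at this
  exact (sub_eq_zero.mp this).symm

/-! ### The Fourier transform and the trapezoidal rule on the whole line -/

section Strip

variable {F : ℂ → ℂ} {d Q P α β : ℝ}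

/-- Paley–Wiener decay: moving the line of integration to `Im ζ = ∓s` gains `e^{-2πs|ξ|}` for
every `s < d`. -/
theorem norm_fourier_le (hd : 0 < d) (hα : 0 < α) (hβ : 0 < β)
    (hF : DifferentiableOn ℂ F (strip d))
    (hb : ∀ ζ ∈ strip d, ‖F ζ‖ ≤ envelope Q P α β ζ.re) (ξ : ℝ) :
    ‖𝓕 (fun x : ℝ => F x) ξ‖ ≤ (Q / α + P / β) * Real.exp (-(2 * Real.pi * d * |ξ|)) := by
  have hnorm : ∀ ζ : ℂ, ‖Complex.exp (-(2 * Real.pi * ξ) * ζ * Complex.I)‖ =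
      Real.exp (2 * Real.pi * ξ * ζ.im) := by
    intro ζ
    rw [Complex.norm_exp]
    simp
  set G : ℂ → ℂ := fun ζ => Complex.exp (-(2 * Real.pi * ξ) * ζ * Complex.I) * F ζ with hGdef
  have hG : DifferentiableOn ℂ G (strip d) :=
    (Differentiable.differentiableOn (by fun_prop)).mul hF
  have hFG : 𝓕 (fun x : ℝ => F x) ξ = ∫ x : ℝ, G x := by
    rw [Real.fourier_real_eq_integral_exp_smul]
    congr 1
    ext x
    simp only [hGdef, smul_eq_mul]
    congr 2
    push_cast
    ring
  have hE := integrable_envelope Q P hα hβ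
  have hGE : ∀ ζ ∈ strip d,
      ‖G ζ‖ ≤ Real.exp (2 * Real.pi * |ξ| * d) * envelope Q P α β ζ.re := by
    intro ζ hζ
    rw [hGdef, norm_mul, hnorm]
    refine mul_le_mul (Real.exp_le_exp.mpr ?_) (hb ζ hζ) (norm_nonneg _) (Real.exp_nonneg _)
    have h1 : ξ * ζ.im ≤ |ξ| * d := by
      refine (le_abs_self _).trans ?_
      rw [abs_mul]
      exact mul_le_mul_of_nonneg_left (le_of_lt hζ) (abs_nonneg _)
    nlinarith [Real.pi_pos]
  have hs : ∀ s ∈ Ioo 0 d, ‖𝓕 (fun x : ℝ => F x) ξ‖ ≤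
      (Q / α + P / β) * Real.exp (-(2 * Real.pi * s * |ξ|)) := by
    intro s hs
    -- the shift goes downwards for `ξ ≥ 0` and upwards otherwise
    obtain ⟨y, hy, hξ⟩ : ∃ y : ℝ, |y| = s ∧ ξ * y = -(s * |ξ|) := by
      rcases le_total 0 ξ with h | h
      · exact ⟨-s, by rw [abs_neg, abs_of_pos hs.1], by rw [abs_of_nonneg h]; ring⟩
      · exact ⟨s, abs_of_pos hs.1, by rw [abs_of_nonpos h]; ring⟩
    have hyd : |y| < d := hy ▸ hs.2
    have htop := (tendsto_envelope_atTop Q P α hβ).const_mul (Real.exp (2 * Real.pi * |ξ| * d))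
    have hbot := (tendsto_envelope_atBot Q P β hα).const_mul (Real.exp (2 * Real.pi * |ξ| * d))
    rw [mul_zero] at htop hbot
    rw [hFG, ← integral_horizontal_eq hG (hE.const_mul _) hbot htop hGE hyd,
      ← integral_envelope Q P hα hβ, mul_comm (integral _ _), ← integral_const_mul]
    refine norm_integral_le_of_norm_le (hE.const_mul _) (ae_of_all _ fun x => ?_)
    have h1 := hb _ (add_mul_I_mem_strip hyd x)
    rw [hGdef, norm_mul, hnorm]
    simp only [Complex.add_im, Complex.ofReal_im, Complex.mul_im, Complex.ofReal_re,
      Complex.I_im, mul_one, Complex.I_re, mul_zero, add_zero, zero_add, Complex.add_re,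
      Complex.mul_re, sub_zero] at h1 ⊢
    rw [mul_assoc, hξ, show 2 * Real.pi * -(s * |ξ|) = -(2 * Real.pi * s * |ξ|) by ring]
    exact mul_le_mul_of_nonneg_left h1 (Real.exp_nonneg _)
  have hcont : Tendsto (fun s : ℝ => (Q / α + P / β) * Real.exp (-(2 * Real.pi * s * |ξ|)))
      (𝓝[<] d) (𝓝 ((Q / α + P / β) * Real.exp (-(2 * Real.pi * d * |ξ|)))) :=
    (Continuous.tendsto (by fun_prop) d).mono_left nhdsWithin_le_nhds
  refine ge_of_tendsto hcont ?_
  filter_upwards [Ioo_mem_nhdsLT hd] with s h using hs s h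

/-- The error of the trapezoidal rule with unit mesh, from the Poisson summation formula
`∑ F(k) = ∑ (𝓕 F)(k)`, whose zeroth term on the right is the integral. -/
theorem norm_integral_sub_tsum_le (hd : 0 < d) (hα : 0 < α) (hβ : 0 < β)
    (hF : DifferentiableOn ℂ F (strip d))
    (hb : ∀ ζ ∈ strip d, ‖F ζ‖ ≤ envelope Q P α β ζ.re) :
    ‖(∫ x : ℝ, F x) - ∑' k : ℤ, F k‖ ≤
      2 * (Q / α + P / β) * Real.exp (-(2 * Real.pi * d)) / (1 - Real.exp (-(2 * Real.pi * d))) := by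
  set S := Q / α + P / β
  set r := Real.exp (-(2 * Real.pi * d)) with hr
  have hr1 : r < 1 := by
    rw [hr, Real.exp_lt_one_iff]
    simp only [Left.neg_neg_iff]
    positivity
  have hr0 : 0 ≤ r := Real.exp_nonneg _
  have hc : Continuous fun x : ℝ => F x :=
    hF.continuousOn.comp_continuous (by fun_prop) (ofReal_mem_strip hd)
  have hdec : (fun x : ℝ => F x) =O[cocompact ℝ] fun x : ℝ => |x| ^ (-2 : ℝ) := by
    refine (Asymptotics.isBigO_of_le _ fun x => ?_).trans (envelope_isBigO Q P hα hβ)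
    exact (hb x (ofReal_mem_strip hd x)).trans (le_abs_self _)
  have hfour := norm_fourier_le hd hα hβ hF hb
  have hpow : ∀ n : ℕ, ∀ ξ : ℝ, |ξ| = n + 1 → ‖𝓕 (fun x : ℝ => F x) ξ‖ ≤ S * r * r ^ n := by
    intro n ξ hξ
    refine (hfour ξ).trans (le_of_eq ?_)
    rw [hξ, mul_assoc S, ← pow_succ', hr, ← Real.exp_nat_mul]
    congr 2
    push_cast
    ring
  have hgeo : HasSum (fun n : ℕ => S * r * r ^ n) (S * r * (1 - r)⁻¹) :=
    (hasSum_geometric_of_lt_one hr0 hr1).mul_left _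
  have hp : ∀ n : ℕ, ‖𝓕 (fun x : ℝ => F x) (((n : ℤ) + 1 : ℤ) : ℝ)‖ ≤ S * r * r ^ n :=
    fun n => hpow n _ (by push_cast; exact abs_of_nonneg (by positivity))
  have hm : ∀ n : ℕ, ‖𝓕 (fun x : ℝ => F x) ((-((n : ℤ) + 1) : ℤ) : ℝ)‖ ≤ S * r * r ^ n :=
    fun n => hpow n _ (by push_cast; rw [abs_neg]; exact abs_of_nonneg (by positivity))
  have hsp := (Summable.of_norm_bounded hgeo.summable hp).hasSum
  have hsm := (Summable.of_norm_bounded hgeo.summable hm).hasSum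
  have hsum := HasSum.of_add_one_of_neg_add_one
    (f := fun k : ℤ => 𝓕 (fun x : ℝ => F x) (k : ℝ)) hsp hsm
  have hpoisson := Real.tsum_eq_tsum_fourier_of_rpow_decay_of_summable hc one_lt_two hdec
    hsum.summable 0
  simp only [zero_add, QuotientAddGroup.mk_zero, fourier_eval_zero, mul_one,
    Complex.ofReal_intCast] at hpoisson
  have h0 : 𝓕 (fun x : ℝ => F x) ((0 : ℤ) : ℝ) = ∫ x : ℝ, F x := by
    rw [Real.fourier_real_eq_integral_exp_smul]
    simp
  rw [hpoisson, hsum.tsum_eq, h0, show ∀ a b c : ℂ, b - (a + b + c) = -(a + c) by intros; ring,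
    norm_neg]
  calc _ ≤ _ := norm_add_le _ _
    _ ≤ S * r * (1 - r)⁻¹ + S * r * (1 - r)⁻¹ :=
      add_le_add (tsum_of_norm_bounded hgeo hp) (tsum_of_norm_bounded hgeo hm)
    _ = _ := by rw [div_eq_mul_inv]; ring

/-- The case of mesh `h` follows by rescaling the strip. -/
theorem norm_integral_sub_mesh_mul_tsum_le (hd : 0 < d) (hα : 0 < α) (hβ : 0 < β)
    (hF : DifferentiableOn ℂ F (strip d))
    (hb : ∀ ζ ∈ strip d, ‖F ζ‖ ≤ envelope Q P α β ζ.re) {h : ℝ} (hh : 0 < h) :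
    ‖(∫ x : ℝ, F x) - h * ∑' k : ℤ, F (k * h)‖ ≤
      2 * (Q / α + P / β) * Real.exp (-(2 * Real.pi * d / h)) /
        (1 - Real.exp (-(2 * Real.pi * d / h))) := by
  have hmem : ∀ ζ ∈ strip (d / h), ζ * h ∈ strip d := by
    intro ζ hζ
    simp only [strip, mem_ofPred_eq, Complex.im_mul_ofReal, abs_mul, abs_of_pos hh] at hζ ⊢
    exact (lt_div_iff₀ hh).mp hζ
  have hG : DifferentiableOn ℂ (fun ζ => F (ζ * h)) (strip (d / h)) :=
    hF.comp (Differentiable.differentiableOn (by fun_prop)) hmem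
  have key := norm_integral_sub_tsum_le (div_pos hd hh) (mul_pos hα hh) (mul_pos hβ hh) hG
    (Q := Q) (P := P) fun ζ hζ => by
      refine (hb _ (hmem ζ hζ)).trans (le_of_eq ?_)
      rw [← envelope_mul_left _ _ _ _ _ hh, Complex.re_mul_ofReal, mul_comm]
  have hint : ∫ x : ℝ, F (x * h) = h⁻¹ * ∫ x : ℝ, F x := by
    have := Measure.integral_comp_mul_right (fun x : ℝ => F x) h
    rw [abs_of_pos (inv_pos.mpr hh), Complex.real_smul] at this
    simpa using this
  rw [hint] at key
  have hh' : (h : ℂ) ≠ 0 := by exact_mod_cast hh.ne'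
  have hscale : (∫ x : ℝ, F x) - h * ∑' k : ℤ, F (k * h) =
      h * (h⁻¹ * (∫ x : ℝ, F x) - ∑' k : ℤ, F (k * h)) := by
    rw [Complex.ofReal_inv, mul_sub, mul_inv_cancel_left₀ hh']
  rw [hscale, norm_mul, Complex.norm_of_nonneg hh.le]
  refine (mul_le_mul_of_nonneg_left key hh.le).trans (le_of_eq ?_)
  rw [mul_div_assoc (2 * Real.pi) d h]
  field_simp

end Strip

/-! ### Truncating the series -/

theorem mul_exp_neg_div_one_sub_le {a h : ℝ} (ha : 0 < a) (hh : 0 < h) :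
    h * Real.exp (-(a * h)) / (1 - Real.exp (-(a * h))) ≤ 1 / a := by
  have h1 : Real.exp (-(a * h)) < 1 := by
    rw [Real.exp_lt_one_iff]; have := mul_pos ha hh; linarith
  rw [div_le_div_iff₀ (by linarith) ha]
  have h2 := Real.add_one_le_exp (a * h)
  have h3 : Real.exp (-(a * h)) * Real.exp (a * h) = 1 := by rw [← Real.exp_add]; simp
  nlinarith [Real.exp_pos (-(a * h))]

theorem hasSum_geometric_tail (C : ℝ) {a h : ℝ} (ha : 0 < a) (hh : 0 < h) (m : ℕ) :
    HasSum (fun j : ℕ => C * Real.exp (-(a * ((m + 1 + j : ℕ) * h))))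
      (C * Real.exp (-(a * (m * h))) * (Real.exp (-(a * h)) / (1 - Real.exp (-(a * h))))) := by
  have h1 : Real.exp (-(a * h)) < 1 := by
    rw [Real.exp_lt_one_iff]; have := mul_pos ha hh; linarith
  have := (hasSum_geometric_of_lt_one (Real.exp_nonneg _) h1).mul_left
    (C * Real.exp (-(a * (m * h))) * Real.exp (-(a * h)))
  convert! this using 1
  · ext j
    rw [← Real.exp_nat_mul, mul_assoc, mul_assoc, ← Real.exp_add, ← Real.exp_add]
    congr 2
    push_cast
    ring
  · rw [div_eq_mul_inv]; ring

theorem mesh_mul_norm_tsum_sub_sum_le {u : ℤ → ℂ} {Q P α β h : ℝ} (hα : 0 < α) (hβ : 0 < β)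
    (hQ : 0 ≤ Q) (hP : 0 ≤ P) (hh : 0 < h)
    (hu : ∀ k : ℤ, ‖u k‖ ≤ envelope Q P α β (k * h)) (M N : ℕ) :
    h * ‖∑' k, u k - ∑ k ∈ Finset.Icc (-(M : ℤ)) N, u k‖ ≤
      Q / α * Real.exp (-(α * (M * h))) + P / β * Real.exp (-(β * (N * h))) := by
  set l : ℕ → ℤ := fun j => -((M + 1 + j : ℕ) : ℤ) with hl
  set r : ℕ → ℤ := fun j => ((N + 1 + j : ℕ) : ℤ) with hr
  have hlinj : Function.Injective l := fun i j hij => by simp only [hl] at hij; omega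
  have hrinj : Function.Injective r := fun i j hij => by simp only [hr] at hij; omega
  have hlr : ∀ i j, l i ≠ r j := fun i j hij => by simp only [hl, hr] at hij; omega
  have hlI : ∀ j, l j ∉ Finset.Icc (-(M : ℤ)) N := fun j hj => by
    simp only [hl, Finset.mem_Icc] at hj; omega
  have hrI : ∀ j, r j ∉ Finset.Icc (-(M : ℤ)) N := fun j hj => by
    simp only [hr, Finset.mem_Icc] at hj; omega
  have hcov : ∀ k : ℤ, k ∉ Finset.Icc (-(M : ℤ)) N → k ∈ range l ∨ k ∈ range r := by
    intro k hk
    rcases lt_or_ge k (-(M : ℤ)) with h1 | h1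
    · left; exact ⟨(-k - (M + 1)).toNat, by simp only [hl]; omega⟩
    · right
      have h2 : (N : ℤ) < k := by by_contra! h2; exact hk (Finset.mem_Icc.mpr ⟨h1, h2⟩)
      exact ⟨(k - (N + 1)).toNat, by simp only [hr]; omega⟩
  have hul : ∀ j, ‖u (l j)‖ ≤ Q * Real.exp (-(α * ((M + 1 + j : ℕ) * h))) := by
    intro j
    refine (hu _).trans (le_of_eq ?_)
    have : ((l j : ℤ) : ℝ) * h < 0 :=
      mul_neg_of_neg_of_pos (by simp only [hl]; push_cast; have : (0:ℝ) ≤ M := by positivity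
                                linarith [(by positivity : (0:ℝ) ≤ j)]) hh
    rw [envelope, if_pos this]
    simp only [hl]
    push_cast
    ring_nf
  have hur : ∀ j, ‖u (r j)‖ ≤ P * Real.exp (-(β * ((N + 1 + j : ℕ) * h))) := by
    intro j
    refine (hu _).trans (le_of_eq ?_)
    have : ¬ ((r j : ℤ) : ℝ) * h < 0 := not_lt.mpr (by simp only [hr]; positivity)
    rw [envelope, if_neg this]
    simp only [hr]
    push_cast
    ring_nf
  have hgl := hasSum_geometric_tail Q hα hh M
  have hgr := hasSum_geometric_tail P hβ hh N
  have hsl := (Summable.of_norm_bounded hgl.summable hul).hasSum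
  have hsr := (Summable.of_norm_bounded hgr.summable hur).hasSum
  have hL : HasSum (indicator (range l) u) (∑' j, u (l j)) := by
    rw [← hlinj.hasSum_iff fun k hk => indicator_of_notMem hk u]
    simpa [Function.comp_def] using hsl
  have hR : HasSum (indicator (range r) u) (∑' j, u (r j)) := by
    rw [← hrinj.hasSum_iff fun k hk => indicator_of_notMem hk u]
    simpa [Function.comp_def] using hsr
  have hC : HasSum (indicator (↑(Finset.Icc (-(M : ℤ)) N)) u)
      (∑ k ∈ Finset.Icc (-(M : ℤ)) N, u k) := by
    have := hasSum_sum_of_ne_finset_zero (L := .unconditional ℤ)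
      (f := indicator (↑(Finset.Icc (-(M : ℤ)) (N : ℤ))) u)
      (s := Finset.Icc (-(M : ℤ)) (N : ℤ)) fun k hk => indicator_of_notMem (by simpa using hk) u
    rwa [Finset.sum_congr rfl fun k hk => indicator_of_mem (Finset.mem_coe.mpr hk) u] at this
  have htot : HasSum u (∑' j, u (l j) + ∑' j, u (r j) + ∑ k ∈ Finset.Icc (-(M : ℤ)) N, u k) := by
    convert! (hL.add hR).add hC using 1
    ext k
    by_cases hk : k ∈ Finset.Icc (-(M : ℤ)) N
    · have h1 : k ∉ range l := by rintro ⟨j, rfl⟩; exact hlI j hk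
      have h2 : k ∉ range r := by rintro ⟨j, rfl⟩; exact hrI j hk
      simp only [indicator_of_notMem h1, indicator_of_notMem h2,
        indicator_of_mem (Finset.mem_coe.mpr hk), zero_add]
    · have h3 : k ∉ (↑(Finset.Icc (-(M : ℤ)) (N : ℤ)) : Set ℤ) := by simpa using hk
      rcases hcov k hk with h1 | h1
      · have h2 : k ∉ range r := by
          obtain ⟨i, rfl⟩ := h1; rintro ⟨j, hj⟩; exact hlr i j hj.symm
        simp only [indicator_of_mem h1, indicator_of_notMem h2, indicator_of_notMem h3, add_zero]
      · have h2 : k ∉ range l := by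
          obtain ⟨i, rfl⟩ := h1; rintro ⟨j, hj⟩; exact hlr j i hj
        simp only [indicator_of_mem h1, indicator_of_notMem h2, indicator_of_notMem h3, add_zero,
          zero_add]
  rw [htot.tsum_eq, add_sub_cancel_right]
  have hl' := mul_exp_neg_div_one_sub_le hα hh
  have hr' := mul_exp_neg_div_one_sub_le hβ hh
  calc h * ‖∑' j, u (l j) + ∑' j, u (r j)‖
      ≤ h * (Q * Real.exp (-(α * (M * h))) *
            (Real.exp (-(α * h)) / (1 - Real.exp (-(α * h)))) +
          P * Real.exp (-(β * (N * h))) *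
            (Real.exp (-(β * h)) / (1 - Real.exp (-(β * h))))) := by
        refine mul_le_mul_of_nonneg_left ((norm_add_le _ _).trans ?_) hh.le
        exact add_le_add (tsum_of_norm_bounded hgl hul) (tsum_of_norm_bounded hgr hur)
    _ = Q * Real.exp (-(α * (M * h))) *
            (h * Real.exp (-(α * h)) / (1 - Real.exp (-(α * h)))) +
          P * Real.exp (-(β * (N * h))) *
            (h * Real.exp (-(β * h)) / (1 - Real.exp (-(β * h)))) := by ring
    _ ≤ Q * Real.exp (-(α * (M * h))) * (1 / α) + P * Real.exp (-(β * (N * h))) * (1 / β) := by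
        gcongr
    _ = _ := by ring


/-! ### The map `φ` in terms of `log (1 + e^ζ)` -/

/-- The inner logarithm `L(ζ) = log (1 + e^ζ)` of `φ`, for which `φ = L - 1/L`. -/
noncomputable def softplus (ζ : ℂ) : ℂ := Complex.log (1 + Complex.exp ζ)

theorem phi_eq (ζ : ℂ) : phi ζ = softplus ζ - (softplus ζ)⁻¹ := by
  change 2 * Complex.sinh (Complex.log (softplus ζ)) = _
  by_cases h : softplus ζ = 0
  · simp [h]
  · rw [Complex.sinh, Complex.exp_neg, Complex.exp_log h]
    ring

theorem one_add_exp_mem_slitPlane {ζ : ℂ} (hζ : |ζ.im| < Real.pi) :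
    1 + Complex.exp ζ ∈ Complex.slitPlane := by
  rw [Complex.mem_slitPlane_iff]
  rw [abs_lt] at hζ
  simp only [Complex.add_re, Complex.one_re, Complex.exp_re, Complex.add_im, Complex.one_im,
    Complex.exp_im, zero_add, mul_ne_zero_iff]
  by_cases h : Real.sin ζ.im = 0
  · left
    rw [Real.sin_eq_zero_iff_of_lt_of_lt hζ.1 hζ.2] at h
    rw [h, Real.cos_zero]
    positivity
  · exact Or.inr ⟨Real.exp_ne_zero _, h⟩

theorem exp_softplus {ζ : ℂ} (hζ : |ζ.im| < Real.pi) :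
    Complex.exp (softplus ζ) = 1 + Complex.exp ζ :=
  Complex.exp_log (Complex.slitPlane_ne_zero (one_add_exp_mem_slitPlane hζ))

theorem softplus_ne_zero {ζ : ℂ} (hζ : |ζ.im| < Real.pi) : softplus ζ ≠ 0 := by
  intro h
  have := exp_softplus hζ
  rw [h, Complex.exp_zero] at this
  exact Complex.exp_ne_zero ζ (by linear_combination -this)

theorem hasDerivAt_softplus {ζ : ℂ} (hζ : |ζ.im| < Real.pi) :
    HasDerivAt softplus (Complex.exp ζ / (1 + Complex.exp ζ)) ζ :=
  ((Complex.hasDerivAt_exp ζ).const_add 1).clog (one_add_exp_mem_slitPlane hζ)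

theorem hasDerivAt_phi {ζ : ℂ} (hζ : |ζ.im| < Real.pi) :
    HasDerivAt phi (Complex.exp ζ / (1 + Complex.exp ζ) * (1 + ((softplus ζ)⁻¹) ^ 2)) ζ := by
  have h := (hasDerivAt_softplus hζ).sub ((hasDerivAt_softplus hζ).inv (softplus_ne_zero hζ))
  rw [funext phi_eq]
  convert! h using 1
  field_simp [softplus_ne_zero hζ]
  ring

/-! ### Estimates for `log (1 + e^ζ)` -/

theorem norm_one_add_exp_sq (ζ : ℂ) (t : ℝ) : ‖1 + t * Complex.exp ζ‖ ^ 2 =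
    1 + 2 * t * Real.exp ζ.re * Real.cos ζ.im + (t * Real.exp ζ.re) ^ 2 := by
  rw [Complex.sq_norm, Complex.normSq_apply]
  simp only [Complex.add_re, Complex.one_re, Complex.re_ofReal_mul, Complex.exp_re, Complex.add_im,
    Complex.one_im, Complex.im_ofReal_mul, Complex.exp_im, zero_add]
  linear_combination (t * Real.exp ζ.re) ^ 2 * Real.sin_sq_add_cos_sq ζ.im

theorem cos_half_mul_le_norm_one_add_exp (ζ : ℂ) :
    Real.cos (ζ.im / 2) * (1 + Real.exp ζ.re) ≤ ‖1 + Complex.exp ζ‖ := by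
  refine le_of_sq_le_sq ?_ (norm_nonneg _)
  have h := norm_one_add_exp_sq ζ 1
  have h2 : Real.cos ζ.im = 2 * Real.cos (ζ.im / 2) ^ 2 - 1 := by
    rw [← Real.cos_two_mul]; congr 1; ring
  rw [Complex.ofReal_one, one_mul, h2] at h
  rw [h]
  nlinarith [mul_nonneg (sq_nonneg (1 - Real.exp ζ.re))
    (sub_nonneg.mpr (Real.cos_sq_le_one (ζ.im / 2)))]

theorem norm_inv_one_add_exp_le {ζ : ℂ} {c : ℝ} (hc0 : 0 < c) (hc : 1 ≤ c * Real.cos (ζ.im / 2)) :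
    ‖1 + Complex.exp ζ‖⁻¹ ≤ c / (1 + Real.exp ζ.re) := by
  have hE := Real.exp_pos ζ.re
  have h1 : 1 + Real.exp ζ.re ≤ c * ‖1 + Complex.exp ζ‖ :=
    calc 1 + Real.exp ζ.re ≤ c * Real.cos (ζ.im / 2) * (1 + Real.exp ζ.re) :=
          le_mul_of_one_le_left (by positivity) hc
      _ = c * (Real.cos (ζ.im / 2) * (1 + Real.exp ζ.re)) := by ring
      _ ≤ _ := by gcongr; exact cos_half_mul_le_norm_one_add_exp ζ
  have h2 : 0 < ‖1 + Complex.exp ζ‖ := by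
    by_contra! h
    nlinarith
  rw [inv_eq_one_div, div_le_div_iff₀ h2 (by positivity)]
  linarith

/-- From `|e^z - 1| ≤ e^{|z|} - 1`. -/
theorem log_one_add_norm_exp_sub_one_le (z : ℂ) : Real.log (1 + ‖Complex.exp z - 1‖) ≤ ‖z‖ := by
  have h := Complex.norm_exp_sub_sum_le_exp_norm_sub_sum z 1
  simp only [Finset.range_one, Finset.sum_singleton, pow_zero, Nat.factorial_zero, Nat.cast_one,
    div_one] at h
  rw [Real.log_le_iff_le_exp (by positivity)]
  linarith

theorem log_two_le_norm_softplus {ζ : ℂ} (hζ : |ζ.im| < Real.pi) (hre : 0 ≤ ζ.re) :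
    Real.log 2 ≤ ‖softplus ζ‖ := by
  refine le_trans (Real.log_le_log two_pos ?_) (log_one_add_norm_exp_sub_one_le _)
  rw [exp_softplus hζ, add_sub_cancel_left, Complex.norm_exp]
  linarith [Real.one_le_exp hre]

theorem re_softplus_le_log_two {ζ : ℂ} (hζ : |ζ.im| < Real.pi) (hre : ζ.re ≤ 0) :
    (softplus ζ).re ≤ Real.log 2 := by
  rw [softplus, Complex.log_re]
  refine Real.log_le_log
    (norm_pos_iff.mpr (Complex.slitPlane_ne_zero (one_add_exp_mem_slitPlane hζ))) ?_
  refine (norm_add_le _ _).trans ?_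
  rw [norm_one, Complex.norm_exp]
  linarith [Real.exp_le_one_iff.mpr hre]

theorem one_sub_log_two_pos : 0 < 1 - Real.log 2 := by
  linarith [Real.log_two_lt_d9]

theorem one_sub_log_two_le_norm_softplus_sub_one {ζ : ℂ} (hζ : |ζ.im| < Real.pi)
    (hre : ζ.re ≤ 0) : 1 - Real.log 2 ≤ ‖softplus ζ - 1‖ := by
  have h1 := re_softplus_le_log_two hζ hre
  have h2 := Complex.abs_re_le_norm (softplus ζ - 1)
  have h3 := neg_abs_le (softplus ζ - 1).re
  simp only [Complex.sub_re, Complex.one_re] at h2 h3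
  linarith

/-- With `u = e^ζ / (1 + e^ζ) = 1 - e^{-L}` one has `|L| ≥ log (1 + |u|)`, and by Bernoulli's
inequality `log (1 + |u|) ≥ (|u| / (1 + c)) log (2 + c)` when `|u| ≤ 1 + c`. -/
theorem norm_logDeriv_softplus_le {ζ : ℂ} (hζ : |ζ.im| < Real.pi) {c : ℝ} (hc0 : 0 < c)
    (hc : 1 ≤ c * Real.cos (ζ.im / 2)) :
    ‖Complex.exp ζ / (1 + Complex.exp ζ) / softplus ζ‖ ≤ (1 + c) / Real.log (2 + c) := by
  set u := Complex.exp ζ / (1 + Complex.exp ζ) with hu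
  have hne := Complex.slitPlane_ne_zero (one_add_exp_mem_slitPlane hζ)
  have hulog : Real.log (1 + ‖u‖) ≤ ‖softplus ζ‖ := by
    have h := log_one_add_norm_exp_sub_one_le (-softplus ζ)
    rw [norm_neg, Complex.exp_neg, exp_softplus hζ] at h
    rwa [show (1 + Complex.exp ζ)⁻¹ - 1 = -u by rw [hu]; field_simp; ring, norm_neg] at h
  have huc : ‖u‖ ≤ 1 + c := by
    have hE := Real.exp_pos ζ.re
    rw [hu, norm_div, Complex.norm_exp, div_eq_mul_inv]
    calc _ ≤ Real.exp ζ.re * (c / (1 + Real.exp ζ.re)) := by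
          gcongr; exact norm_inv_one_add_exp_le hc0 hc
      _ ≤ 1 + c := by
          rw [mul_div_assoc', div_le_iff₀ (by positivity)]
          nlinarith
  have hlog : 0 < Real.log (2 + c) := Real.log_pos (by linarith)
  have hL : 0 < ‖softplus ζ‖ := norm_pos_iff.mpr (softplus_ne_zero hζ)
  have hbern : ‖u‖ / (1 + c) * Real.log (2 + c) ≤ Real.log (1 + ‖u‖) := by
    rw [← Real.log_rpow (by linarith)]
    refine Real.log_le_log (Real.rpow_pos_of_pos (by linarith) _) ?_
    have := rpow_one_add_le_one_add_mul_self (s := 1 + c) (by linarith)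
      (p := ‖u‖ / (1 + c)) (by positivity) (by rw [div_le_one (by linarith)]; exact huc)
    rw [div_mul_cancel₀ _ (by linarith)] at this
    rwa [show 2 + c = 1 + (1 + c) by ring]
  rw [norm_div, div_le_div_iff₀ hL hlog]
  have := hbern.trans hulog
  rw [div_mul_eq_mul_div, div_le_iff₀ (by linarith)] at this
  linarith

/-- For `|Im ζ| ≤ 2π/3` the segment from `1` to `1 + e^ζ` stays at distance at least `√3/2 > 6/7`
from the origin. -/
theorem norm_one_add_mul_exp_ge {ζ : ℂ} (hζ : |ζ.im| ≤ 2 * Real.pi / 3) {t : ℝ} (ht : 0 ≤ t) :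
    6 / 7 ≤ ‖1 + t * Complex.exp ζ‖ := by
  refine le_of_sq_le_sq ?_ (norm_nonneg _)
  have hcos : -(1 / 2) ≤ Real.cos ζ.im := by
    have h1 : Real.cos (2 * Real.pi / 3) = -(1 / 2) := by
      rw [show 2 * Real.pi / 3 = Real.pi - Real.pi / 3 by ring, Real.cos_pi_sub,
        Real.cos_pi_div_three]
    rw [← h1, ← Real.cos_abs ζ.im]
    exact Real.cos_le_cos_of_nonneg_of_le_pi (abs_nonneg _) (by linarith [Real.pi_pos]) hζ
  rw [norm_one_add_exp_sq]
  have h2 : 0 ≤ t * Real.exp ζ.re := by positivity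
  nlinarith [sq_nonneg (t * Real.exp ζ.re - 1 / 2)]

theorem norm_softplus_le {ζ : ℂ} (hζ : |ζ.im| ≤ 2 * Real.pi / 3) :
    ‖softplus ζ‖ ≤ 7 / 6 * Real.exp ζ.re := by
  have hpi := Real.pi_pos
  have hslit : ∀ t : ℝ, 0 ≤ t → 1 + t * Complex.exp ζ ∈ Complex.slitPlane := by
    intro t ht
    rcases ht.eq_or_lt with rfl | ht
    · simp
    · have := one_add_exp_mem_slitPlane (ζ := ζ + (Real.log t : ℝ))
        (by simp; linarith)
      rwa [Complex.exp_add, ← Complex.ofReal_exp, Real.exp_log ht, mul_comm] at this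
  have hder : ∀ t ∈ Icc (0 : ℝ) 1, HasDerivWithinAt
      (fun t : ℝ => Complex.log (1 + t * Complex.exp ζ))
      (Complex.exp ζ / (1 + t * Complex.exp ζ)) (Icc 0 1) t := by
    intro t ht
    have h1 : HasDerivAt (fun t : ℝ => 1 + (t : ℂ) * Complex.exp ζ) (Complex.exp ζ) t := by
      simpa using ((Complex.ofRealCLM.hasDerivAt (x := t)).mul_const (Complex.exp ζ)).const_add 1
    exact (h1.clog_real (hslit t ht.1)).hasDerivWithinAt
  have hbd : ∀ t ∈ Icc (0 : ℝ) 1,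
      ‖Complex.exp ζ / (1 + t * Complex.exp ζ)‖ ≤ 7 / 6 * Real.exp ζ.re := by
    intro t ht
    have h1 := norm_one_add_mul_exp_ge hζ ht.1
    have hE := Real.exp_pos ζ.re
    rw [norm_div, Complex.norm_exp, div_le_iff₀ (by linarith)]
    nlinarith
  have := (convex_Icc (0 : ℝ) 1).norm_image_sub_le_of_norm_hasDerivWithin_le hder hbd
    (left_mem_Icc.mpr zero_le_one) (right_mem_Icc.mpr zero_le_one)
  simpa [softplus] using this

theorem norm_softplus_add_one_ge {ζ : ℂ} (hζ : |ζ.im| ≤ 2 * Real.pi / 3) :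
    5 / 6 ≤ ‖softplus ζ + 1‖ := by
  have h1 := norm_one_add_mul_exp_ge hζ zero_le_one
  rw [Complex.ofReal_one, one_mul] at h1
  have h2 : -(1 / 6) ≤ (softplus ζ).re := by
    rw [softplus, Complex.log_re]
    refine le_trans ?_ (Real.log_le_log (by norm_num) h1)
    refine le_trans ?_ (Real.one_sub_inv_le_log_of_pos (by norm_num))
    norm_num
  have h3 := Complex.re_le_norm (softplus ζ + 1)
  simp only [Complex.add_re, Complex.one_re] at h3
  linarith

/-! ### Bounds for `φ` and `φ'` -/

theorem phi_eq_div {ζ : ℂ} (hζ : |ζ.im| < Real.pi) :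
    phi ζ = (softplus ζ - 1) * (softplus ζ + 1) / softplus ζ := by
  rw [phi_eq]
  field_simp [softplus_ne_zero hζ]
  ring

theorem norm_phi_inv_le {ζ : ℂ} (hζ : |ζ.im| ≤ 2 * Real.pi / 3) (hre : ζ.re ≤ 0) {c : ℝ}
    (hc : 1 ≤ c) : ‖phi ζ‖⁻¹ ≤
      Real.exp 1 * c / ((1 - Real.log 2) * (Real.exp 1 - 1)) * Real.exp ζ.re := by
  have hpi := Real.pi_pos
  have hζ' : |ζ.im| < Real.pi := by linarith
  have h1 := one_sub_log_two_le_norm_softplus_sub_one hζ' hre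
  have h2 := norm_softplus_add_one_ge hζ
  have h3 := norm_softplus_le hζ
  have h0 := one_sub_log_two_pos
  have he : 1 < Real.exp 1 := Real.one_lt_exp_iff.mpr one_pos
  have he' := Real.exp_one_lt_d9
  -- `7/6 · 6/5 = 7/5 ≤ e/(e - 1)`
  have h4 : 7 / 5 ≤ Real.exp 1 * c / (Real.exp 1 - 1) := by
    rw [le_div_iff₀ (by linarith)]
    nlinarith
  rw [phi_eq_div hζ', norm_div, norm_mul, inv_div]
  calc ‖softplus ζ‖ / (‖softplus ζ - 1‖ * ‖softplus ζ + 1‖)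
      ≤ 7 / 6 * Real.exp ζ.re / ((1 - Real.log 2) * (5 / 6)) := by gcongr
    _ = 7 / 5 * (Real.exp ζ.re / (1 - Real.log 2)) := by field_simp
    _ ≤ Real.exp 1 * c / (Real.exp 1 - 1) * (Real.exp ζ.re / (1 - Real.log 2)) := by
        gcongr
    _ = _ := by
        field_simp

theorem norm_exp_neg_phi_le {ζ : ℂ} (hζ : |ζ.im| < Real.pi) (hre : 0 ≤ ζ.re) {c : ℝ}
    (hc0 : 0 < c) (hc : 1 ≤ c * Real.cos (ζ.im / 2)) :
    ‖Complex.exp (-phi ζ)‖ ≤ Real.exp lamConst * c * Real.exp (-ζ.re) := by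
  have hL := log_two_le_norm_softplus hζ hre
  have hinv : ‖(softplus ζ)⁻¹‖ ≤ lamConst := by
    rw [norm_inv, lamConst, one_div]
    gcongr
  rw [phi_eq, neg_sub, sub_eq_add_neg, Complex.exp_add, Complex.exp_neg, exp_softplus hζ, norm_mul,
    norm_inv, Complex.norm_exp]
  have h1 : Real.exp ((softplus ζ)⁻¹).re ≤ Real.exp lamConst :=
    Real.exp_le_exp.mpr ((Complex.re_le_norm _).trans hinv)
  have h2 : ‖1 + Complex.exp ζ‖⁻¹ ≤ c * Real.exp (-ζ.re) := by
    refine (norm_inv_one_add_exp_le hc0 hc).trans ?_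
    rw [Real.exp_neg, ← div_eq_mul_inv]
    gcongr
    linarith
  rw [mul_assoc]
  gcongr

theorem norm_deriv_phi_le {ζ : ℂ} (hζ : |ζ.im| < Real.pi) (hre : 0 ≤ ζ.re) {c : ℝ}
    (hc0 : 0 < c) (hc : 1 ≤ c * Real.cos (ζ.im / 2)) :
    ‖deriv phi ζ‖ ≤ (1 + lamConst ^ 2) * c := by
  have hL := log_two_le_norm_softplus hζ hre
  have hinv : ‖(softplus ζ)⁻¹‖ ≤ lamConst := by
    rw [norm_inv, lamConst, one_div]
    gcongr
  rw [(hasDerivAt_phi hζ).deriv, norm_mul, mul_comm]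
  gcongr
  · refine (norm_add_le _ _).trans ?_
    rw [norm_one, norm_pow]
    gcongr
  · rw [norm_div, Complex.norm_exp, div_eq_mul_inv]
    calc _ ≤ Real.exp ζ.re * (c / (1 + Real.exp ζ.re)) := by
          gcongr; exact norm_inv_one_add_exp_le hc0 hc
      _ ≤ c := by
          rw [mul_div_assoc', div_le_iff₀ (by positivity)]
          nlinarith

theorem four_add_phi_sq {ζ : ℂ} (hζ : |ζ.im| < Real.pi) :
    4 + phi ζ ^ 2 = (softplus ζ + (softplus ζ)⁻¹) ^ 2 := by
  rw [phi_eq]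
  field_simp [softplus_ne_zero hζ]
  ring

theorem deriv_phi_eq_mul {ζ : ℂ} (hζ : |ζ.im| < Real.pi) : deriv phi ζ =
    Complex.exp ζ / (1 + Complex.exp ζ) / softplus ζ * (softplus ζ + (softplus ζ)⁻¹) := by
  rw [(hasDerivAt_phi hζ).deriv]
  field_simp [softplus_ne_zero hζ]

/-! ### The transformed integrand -/

section Integrand

variable {f : ℂ → ℂ} {K α β c : ℝ} {ζ : ℂ}

theorem norm_integrand_le_of_re_nonneg (hK : 0 < K) (hβ : 0 < β)
    (hf : ‖f (phi ζ)‖ ≤ K * ‖Complex.exp (-phi ζ)‖ ^ β) (hζ : |ζ.im| < Real.pi)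
    (hre : 0 ≤ ζ.re) (hc0 : 0 < c) (hc : 1 ≤ c * Real.cos (ζ.im / 2)) :
    ‖f (phi ζ) * deriv phi ζ‖ ≤
      K * ((1 + lamConst ^ 2) * c * (Real.exp lamConst * c) ^ β) * Real.exp (-β * ζ.re) := by
  have h1 := norm_exp_neg_phi_le hζ hre hc0 hc
  have h2 := norm_deriv_phi_le hζ hre hc0 hc
  rw [norm_mul]
  calc ‖f (phi ζ)‖ * ‖deriv phi ζ‖
      ≤ K * (Real.exp lamConst * c * Real.exp (-ζ.re)) ^ β * ((1 + lamConst ^ 2) * c) := by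
        refine mul_le_mul (hf.trans ?_) h2 (norm_nonneg _) (by positivity)
        gcongr
    _ = _ := by
        rw [Real.mul_rpow (by positivity) (by positivity), ← Real.exp_mul,
          show -ζ.re * β = -β * ζ.re by ring]
        ring

/-- Since `4 + φ² = (L + 1/L)²` and `φ' = (L'/L) (L + 1/L)`, the square-root factor in the bound
for `f` cancels. At the zeros of `4 + φ²`, where that bound reads `f = 0`, the derivative `φ'`
vanishes too. -/
theorem norm_integrand_le_of_re_neg {A B : ℝ} (hK : 0 < K) (hα : 0 < α)
    (hf : ‖f (phi ζ)‖ ≤ K * (1 / (‖4 + phi ζ ^ 2‖ ^ (1 / 2 : ℝ) * ‖phi ζ‖ ^ α)))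
    (hζ : |ζ.im| < Real.pi) (hA : 0 ≤ A) (hB : 0 ≤ B)
    (hphi : ‖phi ζ‖⁻¹ ≤ A * Real.exp ζ.re)
    (hL : ‖Complex.exp ζ / (1 + Complex.exp ζ) / softplus ζ‖ ≤ B) :
    ‖f (phi ζ) * deriv phi ζ‖ ≤ K * (A ^ α * B) * Real.exp (α * ζ.re) := by
  rw [four_add_phi_sq hζ, norm_pow, ← Real.sqrt_eq_rpow, Real.sqrt_sq (norm_nonneg _)] at hf
  rw [norm_mul, deriv_phi_eq_mul hζ, norm_mul]
  set s := ‖softplus ζ + (softplus ζ)⁻¹‖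
  calc ‖f (phi ζ)‖ * (‖Complex.exp ζ / (1 + Complex.exp ζ) / softplus ζ‖ * s)
      ≤ K * (1 / (s * ‖phi ζ‖ ^ α)) * (B * s) := by gcongr
    _ = K * ‖phi ζ‖⁻¹ ^ α * B * (s⁻¹ * s) := by
        rw [Real.inv_rpow (norm_nonneg _), one_div, mul_inv]; ring
    _ ≤ K * (A * Real.exp ζ.re) ^ α * B * 1 := by
        gcongr
        exact inv_mul_le_one
    _ = _ := by
        rw [Real.mul_rpow hA (Real.exp_nonneg _), ← Real.exp_mul, mul_comm ζ.re α]
        ring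

end Integrand


/-! ### The substitution `x = φ(t)` on the real line -/

theorem softplus_ofReal (t : ℝ) : softplus t = (Real.log (1 + Real.exp t) : ℝ) := by
  rw [softplus, Complex.ofReal_log (by positivity)]
  push_cast
  rfl

theorem log_one_add_exp_pos (t : ℝ) : 0 < Real.log (1 + Real.exp t) :=
  Real.log_pos (by linarith [Real.exp_pos t])

theorem abs_ofReal_im_lt_pi (t : ℝ) : |(t : ℂ).im| < Real.pi := by simpa using Real.pi_pos

/-- The restriction of `φ` to the real line, as a real function. -/
noncomputable def realPhi (t : ℝ) : ℝ :=
  Real.log (1 + Real.exp t) - (Real.log (1 + Real.exp t))⁻¹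

/-- The derivative of `realPhi`. -/
noncomputable def realPhiDeriv (t : ℝ) : ℝ :=
  Real.exp t / (1 + Real.exp t) * (1 + (Real.log (1 + Real.exp t))⁻¹ ^ 2)

theorem phi_ofReal (t : ℝ) : phi t = (realPhi t : ℝ) := by
  rw [phi_eq, softplus_ofReal, realPhi]
  push_cast
  rfl

theorem deriv_phi_ofReal (t : ℝ) : deriv phi t = (realPhiDeriv t : ℝ) := by
  rw [(hasDerivAt_phi (abs_ofReal_im_lt_pi t)).deriv, softplus_ofReal, realPhiDeriv]
  push_cast
  rfl

theorem realPhiDeriv_pos (t : ℝ) : 0 < realPhiDeriv t := by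
  unfold realPhiDeriv
  positivity

theorem hasDerivAt_realPhi (t : ℝ) : HasDerivAt realPhi (realPhiDeriv t) t := by
  have h := (hasDerivAt_phi (abs_ofReal_im_lt_pi t)).real_of_complex
  rw [← (hasDerivAt_phi (abs_ofReal_im_lt_pi t)).deriv, deriv_phi_ofReal, Complex.ofReal_re] at h
  simpa only [phi_ofReal, Complex.ofReal_re] using h

theorem injective_realPhi : Function.Injective realPhi :=
  (strictMono_of_hasDerivAt_pos hasDerivAt_realPhi realPhiDeriv_pos).injective

theorem surjective_realPhi : Function.Surjective realPhi := by
  intro x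
  -- the positive root of `l - 1/l = x`
  set l := (x + √(x ^ 2 + 4)) / 2 with hl
  have hs := Real.sq_sqrt (show 0 ≤ x ^ 2 + 4 by positivity)
  have hl0 : 0 < l := by
    have : |x| < √(x ^ 2 + 4) := by
      rw [← Real.sqrt_sq_eq_abs]
      exact Real.sqrt_lt_sqrt (sq_nonneg x) (by linarith)
    have := neg_abs_le x
    rw [hl]; linarith
  refine ⟨Real.log (Real.exp l - 1), ?_⟩
  rw [realPhi, Real.exp_log (by linarith [Real.one_lt_exp_iff.mpr hl0]), add_sub_cancel,
    Real.log_exp]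
  field_simp
  rw [hl]
  nlinarith

theorem integral_eq_integral_phi (f : ℂ → ℂ) :
    ∫ x : ℝ, f x = ∫ t : ℝ, f (phi t) * deriv phi t := by
  have h := integral_image_eq_integral_abs_deriv_smul MeasurableSet.univ
    (fun t _ => (hasDerivAt_realPhi t).hasDerivWithinAt) injective_realPhi.injOn
    (fun x : ℝ => f x)
  rw [image_univ, surjective_realPhi.range_eq, setIntegral_univ, setIntegral_univ] at h
  rw [h]
  congr 1
  ext t
  rw [phi_ofReal, deriv_phi_ofReal, abs_of_pos (realPhiDeriv_pos t), Complex.real_smul, mul_comm]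

theorem integrable_iff_integrable_phi (f : ℂ → ℂ) :
    Integrable (fun x : ℝ => f x) ↔ Integrable fun t : ℝ => f (phi t) * deriv phi t := by
  have h := integrableOn_image_iff_integrableOn_abs_deriv_smul MeasurableSet.univ
    (fun t _ => (hasDerivAt_realPhi t).hasDerivWithinAt) injective_realPhi.injOn
    (fun x : ℝ => f x)
  rw [image_univ, surjective_realPhi.range_eq, integrableOn_univ, integrableOn_univ] at h
  rw [h]
  congr! 2 with t
  rw [phi_ofReal, deriv_phi_ofReal, abs_of_pos (realPhiDeriv_pos t), Complex.real_smul, mul_comm]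

theorem norm_logDeriv_softplus_ofReal_le (t : ℝ) :
    ‖Complex.exp t / (1 + Complex.exp t) / softplus t‖ ≤ 1 := by
  have h1 := log_one_add_exp_pos t
  have h2 : Real.exp t / (1 + Real.exp t) ≤ Real.log (1 + Real.exp t) := by
    refine le_trans (le_of_eq ?_) (Real.one_sub_inv_le_log_of_pos (by positivity))
    field_simp
    ring
  have h3 : Complex.exp t / (1 + Complex.exp t) / softplus t =
      ((Real.exp t / (1 + Real.exp t) / Real.log (1 + Real.exp t) : ℝ) : ℂ) := by
    rw [softplus_ofReal]; push_cast; rfl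
  rw [h3, Complex.norm_of_nonneg (by positivity)]
  exact div_le_one_of_le₀ h2 h1.le

theorem norm_phi_ofReal_inv_le {t : ℝ} (ht : t ≤ 0) :
    ‖phi t‖⁻¹ ≤ (1 - Real.log 2)⁻¹ * Real.exp t := by
  have h1 := log_one_add_exp_pos t
  have h0 := one_sub_log_two_pos
  have h2 := one_sub_log_two_le_norm_softplus_sub_one (abs_ofReal_im_lt_pi t)
    (by simpa using ht)
  have h3 : Real.log (1 + Real.exp t) ≤ Real.exp t := by
    linarith [Real.log_le_sub_one_of_pos (show 0 < 1 + Real.exp t by positivity)]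
  have h4 : 1 ≤ ‖softplus t + 1‖ := by
    rw [softplus_ofReal, ← Complex.ofReal_one, ← Complex.ofReal_add,
      Complex.norm_of_nonneg (by positivity)]
    linarith
  rw [phi_eq_div (abs_ofReal_im_lt_pi t), norm_div, norm_mul, inv_div]
  calc ‖softplus t‖ / (‖softplus t - 1‖ * ‖softplus t + 1‖)
      ≤ Real.exp t / ((1 - Real.log 2) * 1) := by
        gcongr
        rwa [softplus_ofReal, Complex.norm_of_nonneg h1.le]
    _ = _ := by rw [mul_one, div_eq_mul_inv, mul_comm]

/-! ### Majorants of the transformed integrand -/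

section Majorant

variable {f : ℂ → ℂ} {d K α β : ℝ}

theorem cos_half_pos (hd0 : 0 < d) (hd : d < Real.pi) : 0 < Real.cos (d / 2) :=
  Real.cos_pos_of_mem_Ioo ⟨by linarith [Real.pi_pos], by linarith⟩

theorem one_le_cConst (hd0 : 0 < d) (hd : d < Real.pi) : 1 ≤ cConst d := by
  rw [cConst, le_div_iff₀ (cos_half_pos hd0 hd), one_mul]
  exact Real.cos_le_one _

theorem one_le_cConst_mul_cos (hd : d < Real.pi) {ζ : ℂ} (hζ : ζ ∈ strip d) :
    1 ≤ cConst d * Real.cos (ζ.im / 2) := by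
  have hζ' : |ζ.im| < d := hζ
  have hd0 : 0 < d := (abs_nonneg _).trans_lt hζ'
  rw [cConst, one_div_mul_eq_div, le_div_iff₀ (cos_half_pos hd0 hd), one_mul,
    ← Real.cos_abs (ζ.im / 2), abs_div, abs_two]
  exact Real.cos_le_cos_of_nonneg_of_le_pi (by positivity) (by linarith) (by linarith)

theorem norm_integrand_le_envelope (hd : d < (1 + Real.pi) / 2)
    (hK : 0 < K) (hα : 0 < α) (hβ : 0 < β)
    (hpos : ∀ z ∈ phi '' stripPos d, ‖f z‖ ≤ K * ‖Complex.exp (-z)‖ ^ β)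
    (hneg : ∀ z ∈ phi '' stripNeg d,
      ‖f z‖ ≤ K * (1 / (‖4 + z ^ 2‖ ^ (1 / 2 : ℝ) * ‖z‖ ^ α)))
    {ζ : ℂ} (hζ : ζ ∈ strip d) :
    ‖f (phi ζ) * deriv phi ζ‖ ≤ envelope
      (K * ((Real.exp 1 * cConst d / ((1 - Real.log 2) * (Real.exp 1 - 1))) ^ α *
        ((1 + cConst d) / Real.log (2 + cConst d))))
      (K * ((1 + lamConst ^ 2) * cConst d * (Real.exp lamConst * cConst d) ^ β)) α β ζ.re := by
  have hpi := Real.pi_gt_three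
  have hζ' : |ζ.im| < d := hζ
  have hdpi : d < Real.pi := by linarith
  have hζpi : |ζ.im| < Real.pi := hζ'.trans hdpi
  have hc1 := one_le_cConst ((abs_nonneg _).trans_lt hζ') hdpi
  have hc := one_le_cConst_mul_cos hdpi hζ
  have hlog : 0 < Real.log (2 + cConst d) := Real.log_pos (by linarith)
  have h0 := one_sub_log_two_pos
  have he : 0 < Real.exp 1 - 1 := sub_pos.mpr (Real.one_lt_exp_iff.mpr one_pos)
  rcases lt_or_ge ζ.re 0 with hre | hre
  · rw [envelope, if_pos hre]
    -- `(1 + π) / 2 ≤ 2π / 3` because `π ≥ 3`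
    exact norm_integrand_le_of_re_neg hK hα (hneg _ ⟨ζ, ⟨hζ, hre⟩, rfl⟩) hζpi
      (by positivity) (by positivity) (norm_phi_inv_le (by linarith) hre.le hc1)
      (norm_logDeriv_softplus_le hζpi (by linarith) hc)
  · rw [envelope, if_neg (not_lt.mpr hre)]
    exact norm_integrand_le_of_re_nonneg hK hβ (hpos _ ⟨ζ, ⟨hζ, hre⟩, rfl⟩) hζpi hre
      (by linarith) hc

theorem norm_integrand_ofReal_le_envelope (hd : 0 < d)
    (hK : 0 < K) (hα : 0 < α) (hβ : 0 < β)
    (hpos : ∀ z ∈ phi '' stripPos d, ‖f z‖ ≤ K * ‖Complex.exp (-z)‖ ^ β)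
    (hneg : ∀ z ∈ phi '' stripNeg d,
      ‖f z‖ ≤ K * (1 / (‖4 + z ^ 2‖ ^ (1 / 2 : ℝ) * ‖z‖ ^ α)))
    (t : ℝ) :
    ‖f (phi t) * deriv phi t‖ ≤ envelope (K * (1 - Real.log 2)⁻¹ ^ α)
      (K * ((1 + lamConst ^ 2) * Real.exp lamConst ^ β)) α β t := by
  have ht := ofReal_mem_strip hd t
  have h0 := one_sub_log_two_pos
  rcases lt_or_ge t 0 with hre | hre
  · rw [envelope, if_pos hre]
    simpa using norm_integrand_le_of_re_neg hK hα (hneg _ ⟨t, ⟨ht, by simpa using hre⟩, rfl⟩)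
      (abs_ofReal_im_lt_pi t) (inv_nonneg.mpr h0.le) zero_le_one
      (by simpa using norm_phi_ofReal_inv_le hre.le) (norm_logDeriv_softplus_ofReal_le t)
  · rw [envelope, if_neg (not_lt.mpr hre)]
    simpa using norm_integrand_le_of_re_nonneg hK hβ
      (hpos _ ⟨t, ⟨ht, by simpa using hre⟩, rfl⟩) (abs_ofReal_im_lt_pi t) (by simpa using hre)
      one_pos (by simp)

theorem differentiableOn_integrand (hd : d < Real.pi)
    (hf : AnalyticOnNhd ℂ f (phi '' strip d)) :
    DifferentiableOn ℂ (fun ζ => f (phi ζ) * deriv phi ζ) (strip d) := by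
  have hphi : DifferentiableOn ℂ phi (strip d) := fun ζ hζ =>
    (hasDerivAt_phi (lt_trans hζ hd)).differentiableAt.differentiableWithinAt
  exact (hf.differentiableOn.comp hphi (mapsTo_image _ _)).mul (hphi.deriv (isOpen_strip d))

end Majorant

/-! ### The mesh and the truncation indices -/

section Parameters

variable {d α β : ℝ} {n : ℕ}

theorem mesh_pos (hd : 0 < d) (hα : 0 < α) (hβ : 0 < β) (hn : 1 ≤ n) : 0 < mesh d α β n := by
  have hn' : (0 : ℝ) < n := by exact_mod_cast hn
  exact Real.sqrt_pos.mpr (by positivity)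

theorem min_mul_mesh (hd : 0 < d) (hα : 0 < α) (hβ : 0 < β) (hn : 1 ≤ n) :
    min α β * n * mesh d α β n = √(2 * Real.pi * d * min α β * n) := by
  have hn' : (0 : ℝ) < n := by exact_mod_cast hn
  rw [mesh, eq_comm, Real.sqrt_eq_iff_mul_self_eq (by positivity) (by positivity),
    mul_mul_mul_comm, Real.mul_self_sqrt (by positivity)]
  field_simp

theorem two_pi_mul_div_mesh (hd : 0 < d) (hα : 0 < α) (hβ : 0 < β) (hn : 1 ≤ n) :
    2 * Real.pi * d / mesh d α β n = √(2 * Real.pi * d * min α β * n) := by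
  have hn' : (0 : ℝ) < n := by exact_mod_cast hn
  have hsq : mesh d α β n * mesh d α β n = 2 * Real.pi * d / (min α β * n) :=
    Real.mul_self_sqrt (by positivity)
  rw [← min_mul_mesh hd hα hβ hn, div_eq_iff (mesh_pos hd hα hβ hn).ne', mul_assoc _ (mesh _ _ _ _),
    hsq]
  field_simp

theorem min_mul_le_mul_truncM (hα : 0 < α) : min α β * n ≤ α * truncM α β n := by
  unfold truncM
  split_ifs with h
  · rw [h]
  · rw [min_eq_right (le_of_not_ge fun h' => h (min_eq_left h'))]
    have := Nat.le_ceil (β * n / α)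
    rw [div_le_iff₀ hα] at this
    linarith

theorem min_mul_le_mul_truncN (hβ : 0 < β) : min α β * n ≤ β * truncN α β n := by
  unfold truncN
  split_ifs with h
  · rw [h]
    have := Nat.le_ceil (α * n / β)
    rw [div_le_iff₀ hβ] at this
    linarith
  · rw [min_eq_right (le_of_not_ge fun h' => h (min_eq_left h'))]

theorem C5_lt_C3 (hd0 : 0 < d) (hd : d < Real.pi) (hα : 0 < α) : C5 d α β < C3 d α β := by
  have hc := one_le_cConst hd0 hd
  have h0 := one_sub_log_two_pos
  have he : 0 < Real.exp 1 - 1 := sub_pos.mpr (Real.one_lt_exp_iff.mpr one_pos)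
  have hl2 := Real.log_pos one_lt_two
  set A := Real.exp 1 * cConst d / ((1 - Real.log 2) * (Real.exp 1 - 1)) with hA
  have hA1 : 1 < A := by
    rw [hA, one_lt_div (by positivity)]
    nlinarith [Real.exp_pos 1]
  have hlog : 0 < Real.log (2 + cConst d) := Real.log_pos (by linarith)
  unfold C5 C3
  rw [← hA]
  set l := Real.log (2 + cConst d)
  set c := cConst d
  refine add_lt_add_left ?_ _
  have hl : (1 + c) / l < (1 + l ^ 2) / l ^ 2 * (1 + c) ^ 2 := by
    rw [div_mul_eq_mul_div, div_lt_div_iff₀ hlog (by positivity)]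
    have h1 : l < 1 + l ^ 2 := by nlinarith [sq_nonneg (l - 1)]
    have h2 : 1 + c < (1 + c) ^ 2 := by nlinarith
    have h3 : l * (1 + c) < (1 + l ^ 2) * (1 + c) ^ 2 := by gcongr
    nlinarith
  have hpow : A ^ α ≤ A ^ (α + 1) := Real.rpow_le_rpow_of_exponent_le hA1.le (by linarith)
  calc 1 / α * A ^ α * ((1 + c) / l)
      < 1 / α * A ^ α * ((1 + l ^ 2) / l ^ 2 * (1 + c) ^ 2) := by gcongr
    _ ≤ (1 / (α + 1) + 1 / α) * A ^ (α + 1) * ((1 + l ^ 2) / l ^ 2 * (1 + c) ^ 2) := by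
        gcongr
        exact le_add_of_nonneg_left (by positivity)
    _ = _ := by ring

theorem C6_lt_C4 (hα : 0 < α) : C6 α β < C4 α β := by
  have h0 := one_sub_log_two_pos
  have hl2 := Real.log_pos one_lt_two
  unfold C6 C4
  refine add_lt_add_left ?_ _
  have h1 : 1 < Real.exp (1 / Real.pi ^ 3) :=
    Real.one_lt_exp_iff.mpr (by have := Real.pi_pos; positivity)
  have h2 : (1 - Real.log 2) ^ (α + 1) ≤ (1 - Real.log 2) ^ α :=
    Real.rpow_le_rpow_of_exponent_ge h0 (by linarith) (by linarith)
  calc 1 / (α * (1 - Real.log 2) ^ α)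
      ≤ 1 / (α * (1 - Real.log 2) ^ (α + 1)) := by gcongr
    _ < _ := by gcongr

end Parameters

end UnilateralTrapezoid

/-! ### The error bound -/

open UnilateralTrapezoid

theorem theorem4 (f : ℂ → ℂ) (d K α β : ℝ)
    (hd0 : 0 < d) (hd : d < (1 + Real.pi) / 2)
    (hK : 0 < K) (hα : 0 < α) (hβ : 0 < β)
    (hf : AnalyticOnNhd ℂ f (UnilateralTrapezoid.phi '' UnilateralTrapezoid.strip d))
    (hpos : ∀ z ∈ UnilateralTrapezoid.phi '' UnilateralTrapezoid.stripPos d,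
      ‖f z‖ ≤ K * ‖Complex.exp (-z)‖ ^ β)
    (hneg : ∀ z ∈ UnilateralTrapezoid.phi '' UnilateralTrapezoid.stripNeg d,
      ‖f z‖ ≤ K * (1 / (‖4 + z ^ 2‖ ^ (1 / 2 : ℝ) * ‖z‖ ^ α))) :
    Integrable (fun x : ℝ => f (x : ℂ)) volume ∧
    (∀ n : ℕ, 1 ≤ n →
      ‖(∫ x : ℝ, f (x : ℂ)) -
          UnilateralTrapezoid.trapezoid f (UnilateralTrapezoid.mesh d α β n)
            (UnilateralTrapezoid.truncM α β n) (UnilateralTrapezoid.truncN α β n)‖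
        ≤ K * (2 * UnilateralTrapezoid.C5 d α β
                / (1 - Real.exp (-Real.sqrt (2 * Real.pi * d * min α β)))
              + UnilateralTrapezoid.C6 α β)
            * Real.exp (-Real.sqrt (2 * Real.pi * d * min α β * n))) ∧
    UnilateralTrapezoid.C5 d α β < UnilateralTrapezoid.C3 d α β ∧
    UnilateralTrapezoid.C6 α β < UnilateralTrapezoid.C4 α β := by
  have hpi := Real.pi_gt_three
  have hdpi : d < Real.pi := by linarith
  have h0 := one_sub_log_two_pos
  have hc1 := one_le_cConst hd0 hdpi
  have hlog : 0 < Real.log (2 + cConst d) := Real.log_pos (by linarith)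
  have he : 0 < Real.exp 1 - 1 := sub_pos.mpr (Real.one_lt_exp_iff.mpr one_pos)
  have hF := differentiableOn_integrand hdpi hf
  have hb := fun ζ => norm_integrand_le_envelope (ζ := ζ) hd hK hα hβ hpos hneg
  have hbR := norm_integrand_ofReal_le_envelope hd0 hK hα hβ hpos hneg
  refine ⟨?_, fun n hn => ?_, C5_lt_C3 hd0 hdpi hα, C6_lt_C4 hα⟩
  · rw [integrable_iff_integrable_phi]
    simpa using integrable_horizontal hF (integrable_envelope _ _ hα hβ) hb
      (y := 0) (by simpa using hd0)
  · have hh := mesh_pos hd0 hα hβ hn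
    have hdiscr := norm_integral_sub_mesh_mul_tsum_le hd0 hα hβ hF hb hh
    have htrunc := mesh_mul_norm_tsum_sub_sum_le (Q := K * (1 - Real.log 2)⁻¹ ^ α)
      (P := K * ((1 + lamConst ^ 2) * Real.exp lamConst ^ β)) hα hβ (by positivity)
      (by positivity) hh
      (u := fun k => f (phi (k * mesh d α β n)) * deriv phi (k * mesh d α β n))
      (fun k => by simpa using hbR (k * mesh d α β n)) (truncM α β n) (truncN α β n)
    have hT := min_mul_mesh hd0 hα hβ hn
    have hM := mul_le_mul_of_nonneg_right (min_mul_le_mul_truncM (β := β) (n := n) hα) hh.le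
    have hN := mul_le_mul_of_nonneg_right (min_mul_le_mul_truncN (α := α) (n := n) hβ) hh.le
    rw [two_pi_mul_div_mesh hd0 hα hβ hn] at hdiscr
    rw [hT] at hM hN
    rw [mul_assoc α] at hM
    rw [mul_assoc β] at hN
    have hn' : (1 : ℝ) ≤ n := by exact_mod_cast hn
    have hT0 : 0 < √(2 * Real.pi * d * min α β) := Real.sqrt_pos.mpr (by positivity)
    have hT1 : √(2 * Real.pi * d * min α β) ≤ √(2 * Real.pi * d * min α β * n) :=
      Real.sqrt_le_sqrt (le_mul_of_one_le_right (by positivity) hn')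
    have hden : 0 < 1 - Real.exp (-√(2 * Real.pi * d * min α β)) := by
      rw [sub_pos, Real.exp_lt_one_iff]; linarith
    set T := √(2 * Real.pi * d * min α β * n)
    set T₁ := √(2 * Real.pi * d * min α β)
    set h := mesh d α β n
    have hC5 : ∀ q p : ℝ, K * q / α + K * p / β = K * (1 / α * q + p / β) := by
      intros; ring
    have hC5pos : 0 ≤ C5 d α β := by unfold C5; positivity
    rw [integral_eq_integral_phi, trapezoid]
    set S := ∑' k : ℤ, f (phi (k * h)) * deriv phi (k * h)
    calc _ ≤ ‖(∫ t : ℝ, f (phi t) * deriv phi t) - h * S‖ + h * ‖S - ∑ k ∈ Finset.Icc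
          (-(truncM α β n : ℤ)) (truncN α β n : ℤ), f (phi (k * h)) * deriv phi (k * h)‖ := by
          refine (norm_sub_le_norm_sub_add_norm_sub _ (h * S) _).trans (le_of_eq ?_)
          rw [← mul_sub, norm_mul, Complex.norm_of_nonneg hh.le]
      _ ≤ 2 * (K * C5 d α β) * Real.exp (-T) / (1 - Real.exp (-T₁)) +
          K * C6 α β * Real.exp (-T) := by
          refine add_le_add (hdiscr.trans ?_) (htrunc.trans ?_)
          · rw [hC5, ← mul_assoc (1 / α), mul_div_right_comm _ _ β, ← C5]
            gcongr
          · have e1 : Real.exp (-(α * (truncM α β n * h))) ≤ Real.exp (-T) :=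
              Real.exp_le_exp.mpr (neg_le_neg hM)
            have e2 : Real.exp (-(β * (truncN α β n * h))) ≤ Real.exp (-T) :=
              Real.exp_le_exp.mpr (neg_le_neg hN)
            refine (add_le_add (mul_le_mul_of_nonneg_left e1 (by positivity))
              (mul_le_mul_of_nonneg_left e2 (by positivity))).trans (le_of_eq ?_)
            rw [C6, Real.inv_rpow h0.le]
            field_simp
      _ = _ := by ring
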